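/- **Theorem (Higuchi, injective images of computable randomness).** Let $\mu$ be the fair coin measure on Cantor space $\{0,1\}^\omega$. For a Borel probability measure $\nu$ on $\{0,1\}^\omega$, a $\nu$-martingale is a function $b:\{0,1\}^{<\omega}\to\mathbb{R}_{\ge 0}$ with $$b(\tau)\,\nu(\tau\{0,1\}^\omega)=b(\tau 0)\,\nu(\tau 0\{0,1\}^\omega)+b(\tau 1)\,\nu(\tau 1\{0,1\}^\omega)\qquad\text{for all }\tau\in\{0,1\}^{<\omega};$$ it succeeds on $Y\in\{0,1\}^\omega$ if $\limsup_{n\to\infty} b(Y\upharpoonright n)=\infty$. It is computable if $b(\tau)$ is a computable real uniformly in $\tau$. A sequence $Y$ is computably random with respect to $\nu$ if no computable $\nu$-martingale succeeds on $Y$, and computably random if this holds for $\nu=\mu$. Let $\Phi:\{0,1\}^\omega\to\{0,1\}^\omega$ be a (total) computable injection. Then for every computably random $X\in\{0,1\}^\omega$, the image $\Phi(X)$ is computably random with respect to the measure $\mu\circ\Phi^{-1}$. -/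

import Mathlib

open MeasureTheory Filter
open scoped NNReal ENNReal

/-- Cantor space `{0,1}^ω`, with the product topology and the product (Borel) σ-algebra. -/
abbrev Cantor : Type := ℕ → Bool

namespace Cantor

/-- The initial segment `X ↾ n`, the list `[X 0, …, X (n - 1)]`. -/
def pre (X : Cantor) (n : ℕ) : List Bool := (List.range n).map X

/-- The cylinder `τ{0,1}^ω` of all infinite extensions of the finite string `τ`. -/
def cyl (τ : List Bool) : Set Cantor := {X | X.pre τ.length = τ}

/-- The fair coin measure: the product of countably many uniform measures on `{0,1}`. -/
noncomputable def fairCoin : Measure Cantor :=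
  Measure.infinitePi fun _ : ℕ => (PMF.uniformOfFintype Bool).toMeasure

/-- `Φ` is a (total) computable function on Cantor space: some computable monotone function `φ` on
finite strings produces, from the finite initial segments of `X`, longer and longer initial
segments of `Φ X`. -/
def IsComputableMap (Φ : Cantor → Cantor) : Prop :=
  ∃ φ : List Bool → List Bool, Computable φ ∧
    (∀ σ τ : List Bool, σ <+: τ → φ σ <+: φ τ) ∧
    (∀ (X : Cantor) (n : ℕ), Φ X ∈ cyl (φ (X.pre n))) ∧
    (∀ (X : Cantor) (m : ℕ), ∃ n, m ≤ (φ (X.pre n)).length)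

/-- A function from strings to nonnegative reals is computable if some computable function gives,
for each string `σ` and each precision `n`, an integer `k` with `|b σ - k / 2 ^ n| ≤ 1 / 2 ^ n`,
that is, uniformly computable dyadic approximations. -/
def IsComputableReal (b : List Bool → ℝ≥0) : Prop :=
  ∃ f : List Bool → ℕ → ℕ, Computable₂ f ∧
    ∀ σ n, |(b σ : ℝ) - (f σ n : ℝ) / 2 ^ n| ≤ 1 / 2 ^ n

/-- `b` is a martingale with respect to the measure `ν`:
`b(τ) ν(τ) = b(τ0) ν(τ0) + b(τ1) ν(τ1)` for all strings `τ`. -/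
def IsMartingale (ν : Measure Cantor) (b : List Bool → ℝ≥0) : Prop :=
  ∀ τ : List Bool, (b τ : ℝ≥0∞) * ν (cyl τ) =
    (b (τ ++ [false]) : ℝ≥0∞) * ν (cyl (τ ++ [false])) +
      (b (τ ++ [true]) : ℝ≥0∞) * ν (cyl (τ ++ [true]))

/-- `b` succeeds on `Y`: `limsup b(Y ↾ n) = ∞`. -/
def Succeeds (b : List Bool → ℝ≥0) (Y : Cantor) : Prop :=
  limsup (fun n => (b (Y.pre n) : ℝ≥0∞)) atTop = ⊤

/-- `Y` is computably random with respect to `ν`: no computable `ν`-martingale succeeds on `Y`. -/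
def ComputablyRandom (ν : Measure Cantor) (Y : Cantor) : Prop :=
  ¬ ∃ b : List Bool → ℝ≥0, IsComputableReal b ∧ IsMartingale ν b ∧ Succeeds b Y

/-! Checks on the definitions: computable maps are measurable, so that the pushforward of the fair
coin measure is the expected one, and martingales for the fair coin measure are the usual ones. -/

theorem mem_cyl_iff {X : Cantor} {τ : List Bool} :
    X ∈ cyl τ ↔ ∀ i (h : i < τ.length), X i = τ[i] := by
  constructor
  · intro hX i h
    have hX' : (List.range τ.length).map X = τ := hX
    have := congrArg (fun l => l[i]?) hX'
    simpa [h] using this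
  · intro h
    refine List.ext_getElem (by simp [pre]) ?_
    intro i h1 h2
    simp [pre, h i h2]

theorem IsComputableMap.continuous {Φ : Cantor → Cantor} (h : IsComputableMap Φ) :
    Continuous Φ := by
  obtain ⟨φ, -, -, h1, h2⟩ := h
  refine continuous_pi fun m => ?_
  rw [continuous_iff_continuousAt]
  intro X
  obtain ⟨n, hn⟩ := h2 X (m + 1)
  refine continuousAt_const.congr (f := fun _ => Φ X m) ?_
  have hev : ∀ᶠ Z in nhds X, ∀ i ∈ Finset.range n, Z i = X i := by
    rw [Finset.eventually_all]
    intro i _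
    have : Tendsto (fun Z : Cantor => Z i) (nhds X) (nhds (X i)) := (continuous_apply i).tendsto X
    rw [nhds_discrete Bool] at this
    exact tendsto_pure.1 this
  filter_upwards [hev] with Z hZ
  have hp : Z.pre n = X.pre n := by
    refine List.map_congr_left fun i hi => hZ i (by simpa using hi)
  have a := mem_cyl_iff.1 (h1 X n) m (by omega)
  have c := h1 Z n
  rw [hp] at c
  rw [a, mem_cyl_iff.1 c m (by omega)]

theorem IsComputableMap.measurable {Φ : Cantor → Cantor} (h : IsComputableMap Φ) :
    Measurable Φ := h.continuous.measurable

theorem fairCoin_cyl (τ : List Bool) : fairCoin (cyl τ) = (2⁻¹ : ℝ≥0∞) ^ τ.length := by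
  have : cyl τ = Set.pi (Finset.range τ.length)
      (fun i => {b : Bool | ∀ h : i < τ.length, b = τ[i]}) := by
    ext X
    simp only [mem_cyl_iff, Set.mem_pi, Finset.coe_range, Set.mem_Iio, Set.mem_ofPred_eq]
    exact ⟨fun h i _ hi => h i hi, fun h i hi => h i hi hi⟩
  rw [this, fairCoin, Measure.infinitePi_pi _ (fun _ _ => MeasurableSet.of_discrete)]
  rw [Finset.prod_eq_pow_card (b := (2⁻¹ : ℝ≥0∞)), Finset.card_range]
  intro i hi
  have hi' : i < τ.length := by simpa using hi
  have : {b : Bool | ∀ h : i < τ.length, b = τ[i]} = {τ[i]} := by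
    ext b; simp [hi']
  rw [this, PMF.toMeasure_apply_singleton _ _ (MeasurableSet.of_discrete)]
  simp

theorem isMartingale_fairCoin_iff {b : List Bool → ℝ≥0} :
    IsMartingale fairCoin b ↔ ∀ τ, 2 * b τ = b (τ ++ [false]) + b (τ ++ [true]) := by
  refine forall_congr' fun τ => ?_
  simp only [fairCoin_cyl, List.length_append, List.length_singleton]
  have e : ((2⁻¹ : ℝ≥0∞)) = ((2⁻¹ : ℝ≥0) : ℝ≥0∞) := by simp
  rw [e]
  norm_cast
  have hp : (0 : ℝ≥0) < 2⁻¹ ^ τ.length := by positivity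
  rw [pow_succ, ← add_mul, mul_comm _ (2⁻¹ : ℝ≥0), ← mul_assoc, mul_left_inj' hp.ne',
    eq_mul_inv_iff_mul_eq₀ two_ne_zero, mul_comm]

end Cantor

/-! Suppose a computable martingale `b` for the image measure succeeds on `Φ X`; it is pulled back
to a computable fair-coin martingale succeeding on `X`.

The pullback at `σ` is the average over `Z ∈ cyl σ` of the capital at the first `m` bits of `Φ Z`.
Since `Φ` is injective and Cantor space is compact, some `m` lets those bits decide whether `Z ∈ cyl
σ` (`exists_separates`). Beyond that `m`, each image cylinder has its preimage inside or outside
`cyl σ`, so by the martingale law the average no longer depends on `m` (`mass_succ`). Averages at a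
common level add up over `σ0` and `σ1`, which gives the fair-coin law (`IsMartingale.average`). A
suitable `m` can be found by finite checks on `φ`, and the average is then a finite sum
(`coe_average_eq_sum`), hence computable.

An average may miss success along a single path, because `b` can fall again after being large. So
`b` is first replaced by `saved b f`, which never drops by more than 1 from prefix to extension
(`saved_prefix_le`) and is still unbounded along `Φ X` (`exists_lt_saved`). Once a prefix of `X`
forces `Φ` into a string of large saved capital, the whole average is large (`le_average`). -/

/-! ### Computability of finite sums and unbounded search -/

theorem Computable.list_sum_map {α β : Type*} [Primcodable α] [Primcodable β]
    {l : α → List β} {h : α → β → ℕ} (hl : Computable l) (hh : Computable₂ h) :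
    Computable fun a => ((l a).map (h a)).sum := by
  have key : ∀ a n, Nat.rec (motive := fun _ => ℕ) 0
      (fun k s => s + (((l a)[k]?).map (h a)).getD 0) n = (((l a).take n).map (h a)).sum := by
    intro a n
    induction n with
    | zero => simp
    | succ k ih =>
      simp only [ih]
      rw [List.take_add_one]
      cases hk : (l a)[k]? <;> simp
  have h1 : Computable₂ fun (a : α) (p : ℕ × ℕ) =>
      p.2 + (((l a)[p.1]?).map (h a)).getD 0 := by
    refine Primrec.nat_add.to_comp.comp (Computable.snd.comp Computable.snd) ?_
    refine Computable.option_getD ?_ (Computable.const 0)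
    refine Computable.option_map ?_ ?_
    · exact Computable.list_getElem?.comp (hl.comp Computable.fst)
        (Computable.fst.comp Computable.snd)
    · exact hh.comp (Computable.fst.comp Computable.fst) Computable.snd
  refine (Computable.nat_rec (Computable.list_length.comp hl) (Computable.const 0) h1).of_eq ?_
  intro a
  rw [key, List.take_length]

theorem Computable.exists_search {α : Type*} [Primcodable α] {g : α → ℕ → ℕ}
    (hg : Computable₂ g) (hex : ∀ a, ∃ k, g a k = 0) :
    ∃ s : α → ℕ, Computable s ∧ ∀ a, g a (s a) = 0 := by
  have hp : Partrec₂ fun (a : α) (k : ℕ) => (Part.some (decide (g a k = 0)) : Part Bool) := by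
    have : Computable₂ fun (a : α) (k : ℕ) => decide (g a k = 0) :=
      (Primrec.eq (α := ℕ)).decide.to_comp.comp hg (Computable.const 0)
    exact this.partrec₂
  refine ⟨fun a => Nat.find (hex a), ?_, fun a => Nat.find_spec (hex a)⟩
  refine (Partrec.rfind hp).of_eq_tot fun a => ?_
  refine Nat.mem_rfind.2 ⟨?_, ?_⟩
  · simpa using Nat.find_spec (hex a)
  · intro m hm
    simpa using Nat.find_min (hex a) hm

theorem Primrec.two_pow : Primrec fun n : ℕ => 2 ^ n := by
  refine (Primrec.nat_rec₁ (f := fun _ x => 2 * x) 1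
    (Primrec.nat_double.comp Primrec.snd)).of_eq fun n => ?_
  induction n with
  | zero => rfl
  | succ n ih => rw [pow_succ', ← ih]

/-! ### Binary strings and dyadic approximation -/

namespace Cantor

/-- The list of all binary strings of length `n`. -/
def strings : ℕ → List (List Bool)
  | 0 => [[]]
  | n + 1 => (strings n).flatMap fun τ => [τ ++ [false], τ ++ [true]]

theorem primrec_strings : Primrec strings := by
  have h : Primrec fun τ : List Bool => [τ ++ [false], τ ++ [true]] :=
    Primrec.list_cons.comp (Primrec.list_concat.comp Primrec.id (Primrec.const false))
      (Primrec.list_cons.comp (Primrec.list_concat.comp Primrec.id (Primrec.const true))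
        (Primrec.const []))
  refine (Primrec.nat_rec₁ (f := fun _ l => l.flatMap fun τ => [τ ++ [false], τ ++ [true]]) [[]]
    (Primrec.list_flatMap Primrec.snd (h.comp Primrec.snd).to₂).to₂).of_eq fun n => ?_
  induction n with
  | zero => rfl
  | succ n ih => rw [strings, ← ih]

theorem mem_strings {n : ℕ} {τ : List Bool} : τ ∈ strings n ↔ τ.length = n := by
  induction n generalizing τ with
  | zero => simp [strings]
  | succ n ih =>
    simp only [strings, List.mem_flatMap, ih, List.mem_cons, List.not_mem_nil, or_false]
    constructor
    · rintro ⟨σ, hσ, rfl | rfl⟩ <;> simp [hσ]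
    · intro h
      have hne : τ ≠ [] := by rintro rfl; simp at h
      refine ⟨τ.dropLast, by simp [h], ?_⟩
      have := List.dropLast_append_getLast hne
      cases hl : τ.getLast hne <;> rw [hl] at this <;> simp [this]

theorem sum_strings_succ {M : Type*} [AddCommMonoid M] (F : List Bool → M) (n : ℕ) :
    ((strings (n + 1)).map F).sum =
      ((strings n).map fun τ => F (τ ++ [false]) + F (τ ++ [true])).sum := by
  rw [strings]
  generalize strings n = l
  induction l with
  | nil => simp
  | cons τ l ih =>
    simp only [List.flatMap_cons, List.map_append, List.map_cons, List.map_nil, List.sum_append,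
      List.sum_cons, List.sum_nil, add_zero, ih]

/-- Integer approximations to the multiples `2 ^ N * d σ`, up to an error that does not depend on
`N`, make `d` computable. -/
theorem IsComputableReal.of_approx {d : List Bool → ℝ≥0} {g : List Bool → ℕ → ℕ}
    {C : List Bool → ℕ} (hg : Computable₂ g) (hC : Computable C)
    (h : ∀ σ N, |(d σ : ℝ) * 2 ^ N - g σ N| ≤ C σ) : IsComputableReal d := by
  -- This rounds `g / 2 ^ (1 + C)` to the nearest integer. At precision `n + 1 + C` the error `C ≤ 2
  -- ^ C` becomes at most 1/2 on the scale of `2 ^ n`, and rounding adds at most another 1/2.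
  refine ⟨fun σ n => (2 * g σ (n + 1 + C σ) + 2 ^ (1 + C σ)) / 2 ^ (2 + C σ), ?_, ?_⟩
  · have hC' : Computable₂ fun (σ : List Bool) (_ : ℕ) => C σ := hC.comp Computable.fst
    have hn : Computable₂ fun (_ : List Bool) (n : ℕ) => n := Computable.snd
    have add := Primrec.nat_add.to_comp
    have c (k : ℕ) : Computable₂ fun (_ : List Bool) (_ : ℕ) => k := Computable.const k
    refine Primrec.nat_div.to_comp.comp₂ ?_ ?_
    · refine add.comp₂ ?_ ?_
      · refine Primrec.nat_double.to_comp.comp₂ (hg.comp₂ Computable.fst ?_)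
        exact add.comp₂ (add.comp₂ hn (c 1)) hC'
      · exact Primrec.two_pow.to_comp.comp₂ (add.comp₂ (c 1) hC')
    · exact Primrec.two_pow.to_comp.comp₂ (add.comp₂ (c 2) hC')
  · intro σ n
    set c := C σ
    set x := g σ (n + 1 + c)
    set q := (2 * x + 2 ^ (1 + c)) / 2 ^ (2 + c) with hq
    have hx : |(d σ : ℝ) * 2 ^ (n + 1 + c) - x| ≤ c := h σ (n + 1 + c)
    have hc : (c : ℝ) ≤ 2 ^ c := by exact_mod_cast Nat.lt_two_pow_self.le
    have h1 : (q : ℝ) * 2 ^ (2 + c) ≤ 2 * x + 2 ^ (1 + c) := by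
      exact_mod_cast Nat.div_mul_le_self _ _
    have h2 : (2 * x + 2 ^ (1 + c) : ℝ) < (q + 1) * 2 ^ (2 + c) := by
      have := Nat.lt_div_mul_add (a := 2 * x + 2 ^ (1 + c)) (b := 2 ^ (2 + c)) (by positivity)
      rw [← hq] at this
      rw [add_mul, one_mul]
      exact_mod_cast this
    have p1 : (2 : ℝ) ^ (n + 1 + c) = 2 ^ n * (2 * 2 ^ c) := by ring
    have p2 : (2 : ℝ) ^ (2 + c) = 4 * 2 ^ c := by ring
    have p3 : (2 : ℝ) ^ (1 + c) = 2 * 2 ^ c := by ring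
    rw [p1] at hx
    rw [p2] at h1 h2
    rw [p3] at h1 h2
    have hpos : (0 : ℝ) < 2 ^ c := by positivity
    have hn : (0 : ℝ) < 2 ^ n := by positivity
    obtain ⟨hx1, hx2⟩ := abs_le.1 hx
    have e : (d σ : ℝ) - q / 2 ^ n = (d σ * 2 ^ n - q) / 2 ^ n := by field_simp
    rw [e, abs_div, abs_of_pos hn]
    refine div_le_div_of_nonneg_right (abs_le.2 ⟨?_, ?_⟩) hn.le
    · refine le_of_mul_le_mul_right ?_ hpos
      nlinarith
    · refine le_of_mul_le_mul_right ?_ hpos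
      nlinarith

/-! ### The savings strategy along one sequence -/

/-- The capital at time `n` after betting along `b` with the fraction `1 / K k` at time `k`. -/
noncomputable def savings (b : ℕ → ℝ) (K : ℕ → ℕ) (n : ℕ) : ℝ :=
  1 + ∑ k ∈ Finset.range n, (b (k + 1) - b k) / K k

section savings

variable {b : ℕ → ℝ} {K : ℕ → ℕ}

theorem savings_succ (b : ℕ → ℝ) (K : ℕ → ℕ) (n : ℕ) :
    savings b K (n + 1) = savings b K n + (b (n + 1) - b n) / K n := by
  rw [savings, Finset.sum_range_succ, ← add_assoc, savings]

theorem savings_congr {b' : ℕ → ℝ} {K' : ℕ → ℕ} {n : ℕ} (hb : ∀ k ≤ n, b k = b' k)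
    (hK : ∀ k < n, K k = K' k) : savings b K n = savings b' K' n := by
  unfold savings
  congr 1
  refine Finset.sum_congr rfl fun k hk => ?_
  have := Finset.mem_range.1 hk
  rw [hb k (by omega), hb (k + 1) (by omega), hK k this]

/-- While `K` is constant, savings and `b / K` change by the same amount. When `K` rises, `b / K` is
at least 1/2 at the new bound, so the fall of `b / K` caused by the larger divisor is at least half
of `K (n + 1) / K n - 1`, hence at least half the increase of `log K`. This amount stays saved. -/
theorem savings_lower (hpos : ∀ k, 0 < K k) (hbK : ∀ k, b k ≤ K k)
    (hmono : Monotone K) (hrec : ∀ k, K k < K (k + 1) → (K (k + 1) : ℝ) ≤ 2 * b (k + 1)) (n : ℕ) :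
    b n / K n + (Real.log (K n) - Real.log (K 0)) / 2 ≤ savings b K n := by
  induction n with
  | zero =>
    have : (0 : ℝ) < K 0 := by exact_mod_cast hpos 0
    simpa [savings] using (div_le_one this).2 (hbK 0)
  | succ n ih =>
    rw [savings_succ]
    have p0 : (0 : ℝ) < K n := by exact_mod_cast hpos n
    have p1 : (0 : ℝ) < K (n + 1) := by exact_mod_cast hpos (n + 1)
    suffices h : (Real.log (K (n + 1)) - Real.log (K n)) / 2 ≤
        b (n + 1) / K n - b (n + 1) / K (n + 1) by
      rw [sub_div (b (n + 1))]
      linarith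
    rcases (hmono (Nat.le_succ n)).eq_or_lt with h | h
    · rw [Nat.succ_eq_add_one] at h
      rw [← h]
      simp
    · have hl := Real.log_le_sub_one_of_pos (div_pos p1 p0)
      rw [Real.log_div p1.ne' p0.ne'] at hl
      have hr := hrec n h
      have hK : (K n : ℝ) < K (n + 1) := by exact_mod_cast h
      have e : b (n + 1) / K n - b (n + 1) / K (n + 1) =
          b (n + 1) / K (n + 1) * (K (n + 1) / K n - 1) := by
        field_simp
      rw [e]
      have h1 : 1 / 2 ≤ b (n + 1) / K (n + 1) := by
        rw [le_div_iff₀ p1]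
        linarith
      have h2 : (0 : ℝ) ≤ K (n + 1) / K n - 1 := by
        rw [sub_nonneg, one_le_div p0]
        exact hK.le
      nlinarith

theorem savings_nonneg (h0 : ∀ k, 0 ≤ b k) (hpos : ∀ k, 0 < K k) (hbK : ∀ k, b k ≤ K k)
    (hmono : Monotone K) (hrec : ∀ k, K k < K (k + 1) → (K (k + 1) : ℝ) ≤ 2 * b (k + 1)) (n : ℕ) :
    0 ≤ savings b K n := by
  refine le_trans ?_ (savings_lower hpos hbK hmono hrec n)
  have h1 : Real.log (K 0) ≤ Real.log (K n) :=
    Real.log_le_log (by exact_mod_cast hpos 0) (by exact_mod_cast hmono (Nat.zero_le n))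
  have h2 := div_nonneg (h0 n) (Nat.cast_nonneg (α := ℝ) (K n))
  linarith

/-- The part not at risk, savings minus `b / K`, never decreases, and `b / K` lies between 0 and 1.
-/
theorem savings_le_add_one (h0 : ∀ k, 0 ≤ b k) (hpos : ∀ k, 0 < K k) (hbK : ∀ k, b k ≤ K k)
    (hmono : Monotone K) {n m : ℕ} (hnm : n ≤ m) : savings b K n ≤ savings b K m + 1 := by
  have key : savings b K n + b m / K m ≤ savings b K m + b n / K n := by
    induction m, hnm using Nat.le_induction with
    | base => rfl
    | succ m _ ih =>
      have p0 : (0 : ℝ) < K m := by exact_mod_cast hpos m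
      have : b (m + 1) / K (m + 1) ≤ b (m + 1) / K m :=
        div_le_div_of_nonneg_left (h0 _) p0 (by exact_mod_cast hmono (Nat.le_succ m))
      rw [savings_succ, sub_div]
      linarith
  have p0 : (0 : ℝ) < K n := by exact_mod_cast hpos n
  have h1 := (div_le_one p0).2 (hbK n)
  have h2 := div_nonneg (h0 m) (Nat.cast_nonneg (α := ℝ) (K m))
  linarith

end savings

/-! ### The savings martingale on strings -/

theorem Computable.sum_range {α : Type*} [Primcodable α] {l : α → ℕ} {h : α → ℕ → ℕ}
    (hl : Computable l) (hh : Computable₂ h) :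
    Computable fun a => ∑ k ∈ Finset.range (l a), h a k :=
  (Computable.list_sum_map (Primrec.list_range.to_comp.comp hl) hh).of_eq fun a => by
    simp [Finset.sum, Finset.range, Multiset.range]

/-- A running bound on the approximations with precision `1` along the prefixes of `τ`. -/
def bound (f : List Bool → ℕ → ℕ) (τ : List Bool) : ℕ → ℕ
  | 0 => f [] 0 + 4
  | k + 1 => max (bound f τ k) (f (τ.take (k + 1)) 0 + 1)

theorem computable_bound {f : List Bool → ℕ → ℕ} (hf : Computable₂ f) :
    Computable₂ (bound f) := by
  have h : Computable₂ fun (a : List Bool × ℕ) (p : ℕ × ℕ) =>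
      max p.2 (f (a.1.take (p.1 + 1)) 0 + 1) := by
    refine Primrec.nat_max.to_comp.comp (Computable.snd.comp Computable.snd) ?_
    refine Computable.succ.comp (hf.comp ?_ (Computable.const 0))
    exact Primrec.list_take.to_comp.comp
      (Computable.succ.comp (Computable.fst.comp Computable.snd))
      (Computable.fst.comp Computable.fst)
  refine (Computable.nat_rec Computable.snd (Computable.const (f [] 0 + 4)) h).of_eq ?_
  rintro ⟨τ, n⟩
  induction n with
  | zero => rfl
  | succ n ih => exact congrArg (fun x => max x (f (τ.take (n + 1)) 0 + 1)) ih

theorem bound_mono (f : List Bool → ℕ → ℕ) (τ : List Bool) : Monotone (bound f τ) :=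
  monotone_nat_of_le_succ fun _ => le_max_left _ _

theorem four_le_bound (f : List Bool → ℕ → ℕ) (τ : List Bool) (k : ℕ) : 4 ≤ bound f τ k :=
  le_trans (by simp [bound]) (bound_mono f τ (Nat.zero_le k))

theorem lt_bound (f : List Bool → ℕ → ℕ) (τ : List Bool) (k : ℕ) :
    f (τ.take k) 0 + 1 ≤ bound f τ k := by
  cases k with
  | zero => simp [bound]
  | succ k => exact le_max_right _ _

theorem bound_congr (f : List Bool → ℕ → ℕ) {σ τ : List Bool} {n : ℕ}
    (h : ∀ k ≤ n, σ.take k = τ.take k) : bound f σ n = bound f τ n := by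
  induction n with
  | zero => rfl
  | succ n ih =>
    rw [bound, bound, ih fun k hk => h k (by omega), h (n + 1) le_rfl]

/-- The martingale obtained from `b` by saving part of the gains. -/
noncomputable def saved (b : List Bool → ℝ≥0) (f : List Bool → ℕ → ℕ) (τ : List Bool) : ℝ≥0 :=
  (savings (fun k => b (τ.take k)) (bound f τ) τ.length).toNNReal

section saved

variable {b : List Bool → ℝ≥0} {f : List Bool → ℕ → ℕ}

theorem le_bound (hbf : ∀ σ n, |(b σ : ℝ) - (f σ n : ℝ) / 2 ^ n| ≤ 1 / 2 ^ n) (τ : List Bool)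
    (k : ℕ) : (b (τ.take k) : ℝ) ≤ bound f τ k := by
  have h1 : (f (τ.take k) 0 + 1 : ℝ) ≤ bound f τ k := by exact_mod_cast lt_bound f τ k
  have h2 := (abs_le.1 (hbf (τ.take k) 0)).2
  norm_num at h2
  linarith

/-- A rise sets the bound to `f + 1`, while `b ≥ f - 1`, so `b` is at least the bound minus 2. That
is half the bound or more because the bound is at least 4, which is why it starts at `f [] 0 + 4`.
-/
theorem bound_le_of_lt (hbf : ∀ σ n, |(b σ : ℝ) - (f σ n : ℝ) / 2 ^ n| ≤ 1 / 2 ^ n)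
    (τ : List Bool) (k : ℕ) (h : bound f τ k < bound f τ (k + 1)) :
    (bound f τ (k + 1) : ℝ) ≤ 2 * b (τ.take (k + 1)) := by
  have h4 : (4 : ℝ) ≤ bound f τ (k + 1) := by exact_mod_cast four_le_bound f τ (k + 1)
  have e : bound f τ (k + 1) = f (τ.take (k + 1)) 0 + 1 := by
    rw [bound] at h ⊢
    omega
  have e' : (bound f τ (k + 1) : ℝ) = f (τ.take (k + 1)) 0 + 1 := by exact_mod_cast e
  have h2 := (abs_le.1 (hbf (τ.take (k + 1)) 0)).1
  norm_num at h2
  linarith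

theorem coe_saved (hbf : ∀ σ n, |(b σ : ℝ) - (f σ n : ℝ) / 2 ^ n| ≤ 1 / 2 ^ n) (τ : List Bool) :
    (saved b f τ : ℝ) = savings (fun k => b (τ.take k)) (bound f τ) τ.length :=
  Real.coe_toNNReal _ <| savings_nonneg (fun _ => NNReal.coe_nonneg _)
    (fun k => by have := four_le_bound f τ k; omega) (le_bound hbf τ) (bound_mono f τ)
    (bound_le_of_lt hbf τ) _

theorem take_take_of_le {τ : List Bool} {k n : ℕ} (h : k ≤ n) : (τ.take n).take k = τ.take k := by
  rw [List.take_take, min_eq_left h]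

/-- The divisor at time `k` reads only the first `k` bits, so the capitals of all prefixes of `τ`
belong to one savings process along `τ`. -/
theorem coe_saved_take (hbf : ∀ σ n, |(b σ : ℝ) - (f σ n : ℝ) / 2 ^ n| ≤ 1 / 2 ^ n)
    (τ : List Bool) {n : ℕ} (hn : n ≤ τ.length) :
    (saved b f (τ.take n) : ℝ) = savings (fun k => b (τ.take k)) (bound f τ) n := by
  rw [coe_saved hbf, List.length_take, min_eq_left hn]
  refine savings_congr (fun k hk => by rw [take_take_of_le hk]) fun k hk => ?_
  exact bound_congr f fun j hj => take_take_of_le (by omega)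

theorem saved_prefix_le (hbf : ∀ σ n, |(b σ : ℝ) - (f σ n : ℝ) / 2 ^ n| ≤ 1 / 2 ^ n)
    {σ τ : List Bool} (h : σ <+: τ) : (saved b f σ : ℝ) ≤ saved b f τ + 1 := by
  have e := List.prefix_iff_eq_take.1 h
  have hl := h.length_le
  rw [e, coe_saved_take hbf τ hl, coe_saved hbf]
  exact savings_le_add_one (fun _ => NNReal.coe_nonneg _)
    (fun k => by have := four_le_bound f τ k; omega) (le_bound hbf τ) (bound_mono f τ) hl

theorem log_le_saved (hbf : ∀ σ n, |(b σ : ℝ) - (f σ n : ℝ) / 2 ^ n| ≤ 1 / 2 ^ n)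
    {τ : List Bool} (hb : 0 < b τ) :
    (Real.log (b τ) - Real.log (f [] 0 + 4)) / 2 ≤ saved b f τ := by
  rw [coe_saved hbf]
  have h := savings_lower (fun k => by have := four_le_bound f τ k; omega) (le_bound hbf τ) (bound_mono f τ)
    (bound_le_of_lt hbf τ) τ.length
  refine le_trans ?_ h
  have h1 : Real.log (b τ) ≤ Real.log (bound f τ τ.length) := by
    refine Real.log_le_log (by exact_mod_cast hb) ?_
    simpa using le_bound hbf τ τ.length
  have h2 : (bound f τ 0 : ℝ) = f [] 0 + 4 := by simp [bound]
  rw [h2]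
  have h3 : (0 : ℝ) ≤ b (τ.take τ.length) / bound f τ τ.length := by positivity
  linarith

theorem saved_concat (hbf : ∀ σ n, |(b σ : ℝ) - (f σ n : ℝ) / 2 ^ n| ≤ 1 / 2 ^ n)
    (τ : List Bool) (i : Bool) : (saved b f (τ ++ [i]) : ℝ) =
      saved b f τ + ((b (τ ++ [i]) : ℝ) - b τ) / bound f τ τ.length := by
  have e : (τ ++ [i]).take τ.length = τ := by simp
  have h := coe_saved_take hbf (τ ++ [i]) (n := τ.length) (by simp)
  rw [e] at h
  rw [coe_saved hbf (τ ++ [i]), List.length_append, List.length_singleton, savings_succ, ← h, e]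
  congr 3
  · congr 2
    exact List.take_of_length_le (by simp)
  · exact_mod_cast bound_congr f fun k hk => List.take_append_of_le_length hk

theorem isMartingale_iff_real {ν : Measure Cantor} [IsFiniteMeasure ν] {b : List Bool → ℝ≥0} :
    IsMartingale ν b ↔ ∀ τ, (b τ : ℝ) * ν.real (cyl τ) =
      b (τ ++ [false]) * ν.real (cyl (τ ++ [false])) +
        b (τ ++ [true]) * ν.real (cyl (τ ++ [true])) := by
  refine forall_congr' fun τ => ?_
  have h (σ : List Bool) : (b σ : ℝ≥0∞) * ν (cyl σ) ≠ ⊤ :=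
    ENNReal.mul_ne_top ENNReal.coe_ne_top (measure_ne_top ν _)
  rw [← ENNReal.toReal_eq_toReal_iff' (h _) (ENNReal.add_ne_top.2 ⟨h _, h _⟩),
    ENNReal.toReal_add (h _) (h _)]
  simp [Measure.real]

theorem cyl_concat (τ : List Bool) (i : Bool) :
    cyl (τ ++ [i]) = cyl τ ∩ {X | X τ.length = i} := by
  ext X
  simp only [Set.mem_inter_iff, mem_cyl_iff, Set.mem_ofPred_eq, List.length_append,
    List.length_singleton]
  constructor
  · intro h
    refine ⟨fun j hj => ?_, ?_⟩
    · rw [h j (by omega), List.getElem_append_left hj]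
    · rw [h τ.length (by omega)]
      simp
  · rintro ⟨h1, h2⟩ j hj
    rcases Nat.lt_or_ge j τ.length with h | h
    · rw [h1 j h, List.getElem_append_left h]
    · obtain rfl : j = τ.length := by omega
      rw [h2]
      simp

theorem measurableSet_cyl (τ : List Bool) : MeasurableSet (cyl τ) := by
  have : cyl τ = ⋂ i : ℕ, {X | ∀ h : i < τ.length, X i = τ[i]} := by
    ext X
    simp [mem_cyl_iff]
  rw [this]
  refine MeasurableSet.iInter fun i => ?_
  have : {X : Cantor | ∀ h : i < τ.length, X i = τ[i]} =
      (fun X : Cantor => X i) ⁻¹' {c | ∀ h : i < τ.length, c = τ[i]} := rfl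
  rw [this]
  exact measurable_pi_apply i MeasurableSet.of_discrete

theorem measureReal_inter_preimage_cyl (ν : Measure Cantor) [IsFiniteMeasure ν]
    {Φ : Cantor → Cantor} (hΦ : Measurable Φ) (S : Set Cantor) (τ : List Bool) :
    ν.real (S ∩ Φ ⁻¹' cyl τ) =
      ν.real (S ∩ Φ ⁻¹' cyl (τ ++ [false])) + ν.real (S ∩ Φ ⁻¹' cyl (τ ++ [true])) := by
  have h : MeasurableSet {X : Cantor | Φ X τ.length = true} :=
    ((measurable_pi_apply τ.length).comp hΦ :) (MeasurableSet.singleton true)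
  rw [cyl_concat, cyl_concat, Set.preimage_inter, Set.preimage_inter, ← Set.inter_assoc,
    ← Set.inter_assoc, ← measureReal_inter_add_sdiff (s := S ∩ Φ ⁻¹' cyl τ) h, add_comm]
  congr 2
  ext X
  simp

/-- The divisor is the same for both children of `τ`, so the increments are those of `b` scaled by
one constant; additivity of `ν` handles the capital carried over. -/
theorem IsMartingale.saved {ν : Measure Cantor} [IsFiniteMeasure ν]
    (hbf : ∀ σ n, |(b σ : ℝ) - (f σ n : ℝ) / 2 ^ n| ≤ 1 / 2 ^ n) (hb : IsMartingale ν b) :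
    IsMartingale ν (saved b f) := by
  rw [isMartingale_iff_real] at hb ⊢
  intro τ
  have h1 := hb τ
  have h2 := measureReal_inter_preimage_cyl ν measurable_id Set.univ τ
  simp only [Set.univ_inter, Set.preimage_id] at h2
  have hK : (0 : ℝ) < bound f τ τ.length := by
    have := four_le_bound f τ τ.length
    exact_mod_cast (by omega : 0 < bound f τ τ.length)
  rw [saved_concat hbf, saved_concat hbf]
  field_simp
  rw [h2] at h1 ⊢
  linear_combination h1

theorem abs_natDiv_sub_le {x C : ℝ} {a K : ℕ} (hK : 0 < K) (h : |x - a| ≤ C) :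
    |x / K - (a / K : ℕ)| ≤ C + 1 := by
  have hK' : (1 : ℝ) ≤ K := by exact_mod_cast hK
  have hK0 : (0 : ℝ) < K := by linarith
  have h1 : ((a / K : ℕ) : ℝ) ≤ a / K := Nat.cast_div_le
  have h2 : (a : ℝ) / K < (a / K : ℕ) + 1 := by
    rw [div_lt_iff₀ hK0]
    exact_mod_cast (Nat.lt_mul_div_succ a hK).trans_eq (mul_comm _ _)
  have h3 : |x / K - a / K| ≤ C := by
    rw [← sub_div, abs_div, abs_of_pos hK0]
    exact (div_le_self (abs_nonneg _) hK').trans h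
  rw [abs_le] at h3 ⊢
  constructor <;> linarith

theorem abs_mul_sub_le (hbf : ∀ σ n, |(b σ : ℝ) - (f σ n : ℝ) / 2 ^ n| ≤ 1 / 2 ^ n)
    (σ : List Bool) (n : ℕ) : |(b σ : ℝ) * 2 ^ n - f σ n| ≤ 1 := by
  have hn : (0 : ℝ) < 2 ^ n := by positivity
  have h := hbf σ n
  have e : (b σ : ℝ) - (f σ n : ℝ) / 2 ^ n = ((b σ : ℝ) * 2 ^ n - f σ n) / 2 ^ n := by field_simp
  rwa [e, abs_div, abs_of_pos hn, div_le_div_iff_of_pos_right hn] at h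

theorem IsComputableReal.saved (hf : Computable₂ f)
    (hbf : ∀ σ n, |(b σ : ℝ) - (f σ n : ℝ) / 2 ^ n| ≤ 1 / 2 ^ n) :
    IsComputableReal (saved b f) := by
  -- Each step has two rounded quotients, each off by at most 2, which gives the factor 4. The
  -- natural-number subtraction may truncate to 0, but the approximated value is nonnegative, so
  -- truncation does not increase the error.
  refine IsComputableReal.of_approx (g := fun τ N =>
      (2 ^ N + ∑ k ∈ Finset.range τ.length, f (τ.take (k + 1)) N / bound f τ k) -
        ∑ k ∈ Finset.range τ.length, f (τ.take k) N / bound f τ k)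
      (C := fun τ => 4 * τ.length) ?_ ?_ ?_
  · have key (c : ℕ) : Computable₂ fun (τ : List Bool) (N : ℕ) =>
        ∑ k ∈ Finset.range τ.length, f (τ.take (k + c)) N / bound f τ k := by
      refine Computable.sum_range (α := List Bool × ℕ)
        (h := fun a k => f (a.1.take (k + c)) a.2 / bound f a.1 k)
        (Computable.list_length.comp Computable.fst) ?_
      have hτ : Computable fun p : (List Bool × ℕ) × ℕ => p.1.1 :=
        Computable.fst.comp Computable.fst
      refine Primrec.nat_div.to_comp.comp (hf.comp ?_ ?_) ?_
      · exact Primrec.list_take.to_comp.comp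
          (Primrec.nat_add.to_comp.comp Computable.snd (Computable.const c)) hτ
      · exact Computable.snd.comp Computable.fst
      · exact (computable_bound hf).comp hτ Computable.snd
    exact Primrec.nat_sub.to_comp.comp (Primrec.nat_add.to_comp.comp
      (Primrec.two_pow.to_comp.comp Computable.snd) (key 1)) (key 0)
  · exact Primrec.nat_mul.to_comp.comp (Computable.const 4) Computable.list_length
  · intro τ N
    set A := 2 ^ N + ∑ k ∈ Finset.range τ.length, f (τ.take (k + 1)) N / bound f τ k with hA
    set B := ∑ k ∈ Finset.range τ.length, f (τ.take k) N / bound f τ k with hB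
    have h0 : 0 ≤ (Cantor.saved b f τ : ℝ) * 2 ^ N := by positivity
    have e (p s t u : ℝ) : p + s - (p + t - u) = s - (t - u) := by ring
    have h1 : |(Cantor.saved b f τ : ℝ) * 2 ^ N - ((A : ℝ) - B)| ≤ 4 * τ.length := by
      rw [coe_saved hbf, savings, hA, hB]
      push_cast
      rw [add_mul, one_mul, Finset.sum_mul, e,
        ← Finset.sum_sub_distrib, ← Finset.sum_sub_distrib]
      refine (Finset.abs_sum_le_sum_abs _ _).trans ((Finset.sum_le_card_nsmul _ _ 4 ?_).trans ?_)
      · intro k _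
        have hK : 0 < bound f τ k := by
          have := four_le_bound f τ k
          omega
        have a1 := abs_natDiv_sub_le hK (abs_mul_sub_le hbf (τ.take (k + 1)) N)
        have a2 := abs_natDiv_sub_le hK (abs_mul_sub_le hbf (τ.take k) N)
        rw [sub_div, sub_mul, div_mul_eq_mul_div, div_mul_eq_mul_div]
        rw [abs_le] at a1 a2 ⊢
        constructor <;> linarith
      · simp [mul_comm]
    push_cast
    rw [abs_le] at h1 ⊢
    rcases le_total B A with h | h
    · rw [Nat.cast_sub h]
      exact h1
    · have h' : (A : ℝ) ≤ B := by exact_mod_cast h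
      rw [Nat.sub_eq_zero_of_le h, Nat.cast_zero]
      constructor <;> linarith

end saved

/-! ### Cylinders and compactness -/

instance : IsProbabilityMeasure fairCoin := by
  unfold fairCoin
  infer_instance

theorem length_pre (X : Cantor) (n : ℕ) : (X.pre n).length = n := by simp [pre]

theorem take_pre (X : Cantor) {m n : ℕ} (h : m ≤ n) : (X.pre n).take m = X.pre m := by
  simp [pre, ← List.map_take, List.take_range, min_eq_left h]

theorem mem_cyl_pre (X : Cantor) (n : ℕ) : X ∈ cyl (X.pre n) := by
  show X.pre (X.pre n).length = X.pre n
  rw [length_pre]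

theorem pre_of_mem_cyl {X : Cantor} {τ : List Bool} (h : X ∈ cyl τ) : X.pre τ.length = τ := h

theorem take_of_mem_cyl {X : Cantor} {τ : List Bool} {m : ℕ} (h : X ∈ cyl τ)
    (hm : m ≤ τ.length) : τ.take m = X.pre m := by
  rw [← take_pre X hm, pre_of_mem_cyl h]

theorem prefix_of_mem_cyl {X : Cantor} {σ τ : List Bool} (hσ : X ∈ cyl σ) (hτ : X ∈ cyl τ)
    (h : σ.length ≤ τ.length) : σ <+: τ := by
  rw [List.prefix_iff_eq_take, take_of_mem_cyl hτ h, pre_of_mem_cyl hσ]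

theorem cyl_subset_of_prefix {σ τ : List Bool} (h : σ <+: τ) : cyl τ ⊆ cyl σ := by
  intro X hX
  show X.pre σ.length = σ
  rw [← take_of_mem_cyl hX h.length_le, ← List.prefix_iff_eq_take.1 h]

theorem nonempty_cyl (τ : List Bool) : (cyl τ).Nonempty :=
  ⟨fun i => τ.getD i false, mem_cyl_iff.2 fun i h => by simp [h]⟩

theorem pre_eq_pre_iff {X Y : Cantor} {n : ℕ} : X.pre n = Y.pre n ↔ ∀ i < n, X i = Y i := by
  simp [pre]

theorem isClosed_pre_eq {α : Type*} [TopologicalSpace α] {g h : α → Cantor} (hg : Continuous g)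
    (hh : Continuous h) (n : ℕ) : IsClosed {x | (g x).pre n = (h x).pre n} := by
  simp only [pre_eq_pre_iff, Set.ofPred_forall]
  exact isClosed_iInter fun i => isClosed_iInter fun _ =>
    isClosed_eq ((continuous_apply i).comp hg) ((continuous_apply i).comp hh)

theorem isClopen_pre (P : List Bool → Prop) (n : ℕ) : IsClopen {X : Cantor | P (X.pre n)} := by
  have h : IsLocallyConstant fun X : Cantor => X.pre n := by
    rw [IsLocallyConstant.iff_eventually_eq]
    intro X
    have hev : ∀ᶠ Z in nhds X, ∀ i ∈ Finset.range n, Z i = X i := by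
      rw [Finset.eventually_all]
      intro i _
      have := (continuous_apply (A := fun _ : ℕ => Bool) i).tendsto X
      rw [nhds_discrete Bool] at this
      exact tendsto_pure.1 this
    filter_upwards [hev] with Z hZ
    exact pre_eq_pre_iff.2 fun i hi => hZ i (Finset.mem_range.2 hi)
  exact ⟨⟨h {τ | ¬ P τ}⟩, h {τ | P τ}⟩

/-- The first `m` bits of `Φ Z` decide whether `Z` extends `σ`. -/
def Separates (Φ : Cantor → Cantor) (σ : List Bool) (m : ℕ) : Prop :=
  ∀ Z Z' : Cantor, (Φ Z).pre m = (Φ Z').pre m → Z ∈ cyl σ → Z' ∈ cyl σ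

theorem Separates.mono {Φ : Cantor → Cantor} {σ : List Bool} {m n : ℕ} (h : Separates Φ σ m)
    (hmn : m ≤ n) : Separates Φ σ n := fun Z Z' hZ =>
  h Z Z' (by rw [← take_pre _ hmn, hZ, take_pre _ hmn])

/-- Otherwise the pairs violating separation at level `m` form a decreasing sequence of nonempty
compact sets. A common point is a pair with equal images and exactly one member in `cyl σ`, against
injectivity. -/
theorem exists_separates {Φ : Cantor → Cantor} (hΦ : Continuous Φ) (hinj : Function.Injective Φ)
    (σ : List Bool) : ∃ m, Separates Φ σ m := by
  by_contra! hcon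
  let C : ℕ → Set (Cantor × Cantor) := fun m =>
    {p | (Φ p.1).pre m = (Φ p.2).pre m} ∩ {p | p.1 ∈ cyl σ} ∩ {p | p.2 ∉ cyl σ}
  have hclosed (m : ℕ) : IsClosed (C m) := by
    have hσ : IsClopen (cyl σ) := isClopen_pre (fun τ => τ = σ) σ.length
    refine ((isClosed_pre_eq (hΦ.comp continuous_fst) (hΦ.comp continuous_snd) m).inter ?_).inter ?_
    · exact hσ.isClosed.preimage continuous_fst
    · exact hσ.compl.isClosed.preimage continuous_snd
  obtain ⟨⟨Z, Z'⟩, hp⟩ := IsCompact.nonempty_iInter_of_sequence_nonempty_isCompact_isClosed C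
    (fun m p hp => ⟨⟨by
      have := hp.1.1
      show (Φ p.1).pre m = (Φ p.2).pre m
      rw [← take_pre _ (Nat.le_succ m), this, take_pre _ (Nat.le_succ m)], hp.1.2⟩, hp.2⟩)
    (fun m => by
      have := hcon m
      unfold Separates at this
      push Not at this
      obtain ⟨Z, Z', h1, h2, h3⟩ := this
      exact ⟨(Z, Z'), ⟨h1, h2⟩, h3⟩)
    (hclosed 0).isCompact hclosed
  have hp := Set.mem_iInter.1 hp
  have hZ : Z = Z' := hinj <| funext fun i =>
    pre_eq_pre_iff.1 (hp (i + 1)).1.1 i (Nat.lt_succ_self i)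
  exact (hp 0).2 (hZ ▸ (hp 0).1.2)

/-- Compactness makes the use of `Φ` uniform in `X`: failure at every `n ≥ k` would give, by nested
clopen sets, one `X` on which `φ` never reaches length `m`. -/
theorem exists_length_le {φ : List Bool → List Bool}
    (hmono : ∀ σ τ : List Bool, σ <+: τ → φ σ <+: φ τ)
    (hlen : ∀ (X : Cantor) (m : ℕ), ∃ n, m ≤ (φ (X.pre n)).length) (m k : ℕ) :
    ∃ n, k ≤ n ∧ ∀ X : Cantor, m ≤ (φ (X.pre n)).length := by
  by_contra! hcon
  have hanti (X : Cantor) {i j : ℕ} (h : i ≤ j) :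
      (φ (X.pre i)).length ≤ (φ (X.pre j)).length :=
    (hmono _ _ (by rw [← take_pre X h]; exact List.take_prefix _ _)).length_le
  obtain ⟨X, hX⟩ := IsCompact.nonempty_iInter_of_sequence_nonempty_isCompact_isClosed
    (fun n => {X : Cantor | (φ (X.pre (k + n))).length < m})
    (fun n X hX => (hanti X (by omega)).trans_lt hX)
    (fun n => hcon (k + n) (by omega))
    (isClopen_pre (fun τ => (φ τ).length < m) _).isClosed.isCompact
    (fun n => (isClopen_pre (fun τ => (φ τ).length < m) _).isClosed)
  obtain ⟨n, hn⟩ := hlen X m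
  have h1 : (φ (X.pre (k + n))).length < m := Set.mem_iInter.1 hX n
  have h2 := hanti X (show n ≤ k + n by omega)
  omega

/-! ### Pulling back a martingale by averaging -/

/-- The integral over `S` of `c` evaluated at the first `m` bits of `Φ`. -/
noncomputable def mass (Φ : Cantor → Cantor) (c : List Bool → ℝ≥0) (S : Set Cantor) (m : ℕ) : ℝ :=
  ((strings m).map fun τ => (c τ : ℝ) * fairCoin.real (S ∩ Φ ⁻¹' cyl τ)).sum

section mass

variable {Φ : Cantor → Cantor} {c : List Bool → ℝ≥0}

theorem list_sum_map_congr {α : Type*} {l : List α} {F G : α → ℝ} (h : ∀ x ∈ l, F x = G x) :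
    (l.map F).sum = (l.map G).sum := by
  rw [List.map_congr_left h]

theorem list_sum_map_le {α : Type*} {l : List α} {F G : α → ℝ} (h : ∀ x ∈ l, F x ≤ G x) :
    (l.map F).sum ≤ (l.map G).sum :=
  List.sum_le_sum h

theorem abs_list_sum_map_sub_le {α : Type*} {l : List α} {F G : α → ℝ}
    (h : ∀ x ∈ l, |F x - G x| ≤ 1) : |(l.map F).sum - (l.map G).sum| ≤ l.length := by
  induction l with
  | nil => simp
  | cons x l ih =>
    have h1 := h x (by simp)
    have h2 := ih fun y hy => h y (by simp [hy])
    simp only [List.map_cons, List.sum_cons, List.length_cons]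
    push_cast
    rw [abs_le] at h1 h2 ⊢
    constructor <;> linarith

theorem measureReal_eq_sum (hΦ : Measurable Φ) (S : Set Cantor) (m : ℕ) :
    fairCoin.real S =
      ((strings m).map fun τ => fairCoin.real (S ∩ Φ ⁻¹' cyl τ)).sum := by
  induction m with
  | zero =>
    have : cyl [] = Set.univ := by
      ext X
      simp [mem_cyl_iff]
    simp [strings, this]
  | succ m ih =>
    rw [sum_strings_succ, ih]
    exact list_sum_map_congr fun τ _ => measureReal_inter_preimage_cyl fairCoin hΦ S τ

theorem mass_empty (Φ : Cantor → Cantor) (c : List Bool → ℝ≥0) (m : ℕ) : mass Φ c ∅ m = 0 := by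
  simp [mass]

theorem mass_inter_cyl (S : Set Cantor) (η : List Bool) (m : ℕ) :
    mass Φ c (S ∩ cyl η) m =
      mass Φ c (S ∩ cyl (η ++ [false])) m + mass Φ c (S ∩ cyl (η ++ [true])) m := by
  unfold mass
  rw [← List.sum_map_add]
  refine list_sum_map_congr fun τ _ => ?_
  have h := measureReal_inter_preimage_cyl fairCoin measurable_id (S ∩ Φ ⁻¹' cyl τ) η
  simp only [Set.preimage_id] at h
  rw [Set.inter_right_comm, h, Set.inter_right_comm, Set.inter_right_comm S _ (cyl (η ++ [true])),
    mul_add]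

theorem mass_eq_sum (S : Set Cantor) (m n : ℕ) :
    mass Φ c S m = ((strings n).map fun η => mass Φ c (S ∩ cyl η) m).sum := by
  induction n with
  | zero =>
    have : cyl [] = Set.univ := by
      ext X
      simp [mem_cyl_iff]
    simp [strings, this]
  | succ n ih =>
    rw [sum_strings_succ, ih]
    exact list_sum_map_congr fun η _ => mass_inter_cyl S η m

theorem mass_nonneg (S : Set Cantor) (m : ℕ) : 0 ≤ mass Φ c S m :=
  List.sum_nonneg fun x hx => by
    obtain ⟨τ, -, rfl⟩ := List.mem_map.1 hx
    positivity

theorem le_mass (hΦ : Measurable Φ) {S : Set Cantor} {m : ℕ} {r : ℝ}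
    (h : ∀ Z ∈ S, r ≤ c ((Φ Z).pre m)) : r * fairCoin.real S ≤ mass Φ c S m := by
  rw [measureReal_eq_sum hΦ S m, ← List.sum_map_mul_left]
  refine list_sum_map_le fun τ hτ => ?_
  -- Strings not met by the image of `S` have weight 0, so only values of `c` along actual images
  -- matter.
  rcases (S ∩ Φ ⁻¹' cyl τ).eq_empty_or_nonempty with h0 | ⟨Z, hZ, hZτ⟩
  · simp [h0]
  · refine mul_le_mul_of_nonneg_right ?_ measureReal_nonneg
    have := h Z hZ
    rwa [← mem_strings.1 hτ, pre_of_mem_cyl hZτ] at this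

theorem mass_eq (hΦ : Measurable Φ) {S : Set Cantor} {m : ℕ} {r : ℝ}
    (h : ∀ Z ∈ S, c ((Φ Z).pre m) = r) : mass Φ c S m = r * fairCoin.real S := by
  rw [measureReal_eq_sum hΦ S m, ← List.sum_map_mul_left]
  refine list_sum_map_congr fun τ hτ => ?_
  rcases (S ∩ Φ ⁻¹' cyl τ).eq_empty_or_nonempty with h0 | ⟨Z, hZ, hZτ⟩
  · simp [h0]
  · have := h Z hZ
    rw [← mem_strings.1 hτ, pre_of_mem_cyl hZτ] at this
    rw [this]

/-- By separation, the preimage of each `cyl τ` with `τ` of length `m` either misses `cyl σ` or lies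
inside it. In the second case the summand carries the full image measure, and the martingale law at
`τ` applies. -/
theorem mass_succ (hΦ : Measurable Φ) (hc : IsMartingale (fairCoin.map Φ) c) {σ : List Bool}
    {m : ℕ} (h : Separates Φ σ m) : mass Φ c (cyl σ) (m + 1) = mass Φ c (cyl σ) m := by
  unfold mass
  rw [sum_strings_succ]
  refine list_sum_map_congr fun τ hτ => ?_
  have hsub (i : Bool) : Φ ⁻¹' cyl (τ ++ [i]) ⊆ Φ ⁻¹' cyl τ :=
    Set.preimage_mono (cyl_subset_of_prefix (List.prefix_append _ _))
  rcases (cyl σ ∩ Φ ⁻¹' cyl τ).eq_empty_or_nonempty with h0 | ⟨Z, hZ, hZτ⟩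
  · have h1 (i : Bool) : cyl σ ∩ Φ ⁻¹' cyl (τ ++ [i]) = ∅ :=
      Set.subset_empty_iff.1 (h0 ▸ Set.inter_subset_inter_right _ (hsub i))
    simp [h0, h1]
  · have h1 : Φ ⁻¹' cyl τ ⊆ cyl σ := fun Z' hZ' => h Z Z' (by
      rw [← mem_strings.1 hτ, pre_of_mem_cyl hZτ, pre_of_mem_cyl hZ']) hZ
    rw [Set.inter_eq_right.2 h1, Set.inter_eq_right.2 ((hsub _).trans h1),
      Set.inter_eq_right.2 ((hsub _).trans h1)]
    have := Measure.isProbabilityMeasure_map (μ := fairCoin) hΦ.aemeasurable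
    have h2 := isMartingale_iff_real.1 hc τ
    simp only [map_measureReal_apply hΦ (measurableSet_cyl _)] at h2
    exact h2.symm

theorem mass_eq_of_le (hΦ : Measurable Φ) (hc : IsMartingale (fairCoin.map Φ) c) {σ : List Bool}
    {m n : ℕ} (h : Separates Φ σ m) (hmn : m ≤ n) :
    mass Φ c (cyl σ) n = mass Φ c (cyl σ) m := by
  induction n, hmn using Nat.le_induction with
  | base => rfl
  | succ n hn ih => rw [mass_succ hΦ hc (h.mono hn), ih]

theorem measureReal_cyl (τ : List Bool) : fairCoin.real (cyl τ) = ((2 : ℝ) ^ τ.length)⁻¹ := by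
  simp [Measure.real, fairCoin_cyl]

/-- The average over `cyl σ` of `c` evaluated at the first `s σ` bits of `Φ`. -/
noncomputable def average (Φ : Cantor → Cantor) (c : List Bool → ℝ≥0) (s : List Bool → ℕ)
    (σ : List Bool) : ℝ≥0 :=
  (2 ^ σ.length * mass Φ c (cyl σ) (s σ)).toNNReal

theorem coe_average (s : List Bool → ℕ) (σ : List Bool) :
    (average Φ c s σ : ℝ) = 2 ^ σ.length * mass Φ c (cyl σ) (s σ) :=
  Real.coe_toNNReal _ (mul_nonneg (by positivity) (mass_nonneg _ _))

theorem coe_average_of_le (hΦ : Measurable Φ) (hc : IsMartingale (fairCoin.map Φ) c)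
    {s : List Bool → ℕ} (hs : ∀ σ, Separates Φ σ (s σ)) {σ : List Bool} {m : ℕ} (hm : s σ ≤ m) :
    (average Φ c s σ : ℝ) = 2 ^ σ.length * mass Φ c (cyl σ) m := by
  rw [coe_average, mass_eq_of_le hΦ hc (hs σ) hm]

theorem IsMartingale.average (hΦ : Measurable Φ) (hc : IsMartingale (fairCoin.map Φ) c)
    {s : List Bool → ℕ} (hs : ∀ σ, Separates Φ σ (s σ)) :
    IsMartingale fairCoin (average Φ c s) := by
  rw [isMartingale_fairCoin_iff]
  intro τ
  -- The three averages are compared at one level that separates all three strings.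
  have h0 : s τ ≤ s τ + s (τ ++ [false]) + s (τ ++ [true]) := by omega
  have h1 : s (τ ++ [false]) ≤ s τ + s (τ ++ [false]) + s (τ ++ [true]) := by omega
  have h2 : s (τ ++ [true]) ≤ s τ + s (τ ++ [false]) + s (τ ++ [true]) := by omega
  have h := mass_inter_cyl (Φ := Φ) (c := c) Set.univ τ (s τ + s (τ ++ [false]) + s (τ ++ [true]))
  simp only [Set.univ_inter] at h
  refine NNReal.coe_injective ?_
  push_cast
  rw [coe_average_of_le hΦ hc hs h0, coe_average_of_le hΦ hc hs h1,
    coe_average_of_le hΦ hc hs h2, h]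
  simp only [List.length_append, List.length_singleton]
  ring

theorem le_average (hΦ : Measurable Φ) (hc : IsMartingale (fairCoin.map Φ) c)
    {s : List Bool → ℕ} (hs : ∀ σ, Separates Φ σ (s σ)) {σ τ : List Bool} {r : ℝ}
    (hστ : ∀ Z ∈ cyl σ, Φ Z ∈ cyl τ) (hr : ∀ τ', τ <+: τ' → r ≤ c τ') :
    r ≤ average Φ c s σ := by
  have hm : s σ ≤ s σ + τ.length := by omega
  rw [coe_average_of_le hΦ hc hs hm]
  have h := le_mass (c := c) hΦ (S := cyl σ) (m := s σ + τ.length) (r := r) fun Z hZ =>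
    hr _ (prefix_of_mem_cyl (hστ Z hZ) (mem_cyl_pre _ _) (by rw [length_pre]; omega))
  rw [measureReal_cyl, ← div_eq_mul_inv, div_le_iff₀ (by positivity)] at h
  linarith

/-- With `n` so large that `φ η` has at least `s σ` bits, the integrand is constant on each `cyl η`,
and the integral is a finite sum of values of `c` read off from `φ`. -/
theorem coe_average_eq_sum {φ : List Bool → List Bool} (hΦ : Measurable Φ)
    (hφ : ∀ (X : Cantor) (n : ℕ), Φ X ∈ cyl (φ (X.pre n))) {s : List Bool → ℕ} {σ : List Bool}
    {n : ℕ} (hn : σ.length ≤ n) (hm : ∀ η ∈ strings n, s σ ≤ (φ η).length) :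
    (average Φ c s σ : ℝ) = ((strings n).map fun η =>
      if η.take σ.length = σ then (c ((φ η).take (s σ)) : ℝ) else 0).sum /
        ((2 ^ (n - σ.length) : ℕ) : ℝ) := by
  have hpow : (2 : ℝ) ^ n = 2 ^ σ.length * 2 ^ (n - σ.length) := by
    rw [← pow_add, Nat.add_sub_cancel' hn]
  rw [coe_average, mass_eq_sum _ _ n, ← List.sum_map_mul_left, div_eq_mul_inv,
    ← List.sum_map_mul_right]
  refine list_sum_map_congr fun η hη => ?_
  have hl := mem_strings.1 hη
  split_ifs with h
  · have hp : σ <+: η := List.prefix_iff_eq_take.2 h.symm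
    rw [Set.inter_eq_right.2 (cyl_subset_of_prefix hp),
      mass_eq hΦ (r := (c ((φ η).take (s σ)) : ℝ)), measureReal_cyl, hl, hpow]
    · push_cast
      field_simp
    · intro Z hZ
      have := hφ Z n
      rw [← hl, pre_of_mem_cyl hZ] at this
      rw [take_of_mem_cyl this (hm η hη)]
  · have : cyl σ ∩ cyl η = ∅ := by
      rw [Set.eq_empty_iff_forall_notMem]
      rintro Z ⟨h1, h2⟩
      exact h (List.prefix_iff_eq_take.1 (prefix_of_mem_cyl h1 h2 (hl ▸ hn))).symm
    rw [this, mass_empty, mul_zero, zero_mul]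

end mass

/-! ### Effective search for a separating level -/

/-- The number of violations of the requirement that on strings of length `k.unpair.2` the first
`k.unpair.1` bits of the values of `φ` exist and decide whether `σ` is a prefix. -/
def defects (φ : List Bool → List Bool) (σ : List Bool) (k : ℕ) : ℕ :=
  (σ.length - k.unpair.2) + ((strings k.unpair.2).map fun η =>
    (k.unpair.1 - (φ η).length) + ((strings k.unpair.2).map fun η' =>
      bif decide ((φ η).take k.unpair.1 = (φ η').take k.unpair.1) &&
        (decide (η.take σ.length = σ) && !decide (η'.take σ.length = σ)) then 1 else 0).sum).sum

theorem computable_defects {φ : List Bool → List Bool} (hφ : Computable φ) :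
    Computable₂ (defects φ) := by
  have sub := Primrec.nat_sub.to_comp
  have add := Primrec.nat_add.to_comp
  have take := (Primrec.list_take (α := Bool)).to_comp
  have eq := (Primrec.eq (α := List Bool)).decide.to_comp
  have and := Primrec.and.to_comp
  have fst : Computable fun k : ℕ => k.unpair.1 := Computable.fst.comp Computable.unpair
  have snd : Computable fun k : ℕ => k.unpair.2 := Computable.snd.comp Computable.unpair
  have str := primrec_strings.to_comp
  have σ1 : Computable fun p : (List Bool × ℕ) × List Bool => p.1.1 :=
    Computable.fst.comp Computable.fst
  have k1 : Computable fun p : (List Bool × ℕ) × List Bool => p.1.2 :=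
    Computable.snd.comp Computable.fst
  have σ2 : Computable fun p : ((List Bool × ℕ) × List Bool) × List Bool => p.1.1.1 :=
    σ1.comp Computable.fst
  have k2 : Computable fun p : ((List Bool × ℕ) × List Bool) × List Bool => p.1.1.2 :=
    k1.comp Computable.fst
  have η2 : Computable fun p : ((List Bool × ℕ) × List Bool) × List Bool => p.1.2 :=
    Computable.snd.comp Computable.fst
  have ψ2 : Computable fun p : ((List Bool × ℕ) × List Bool) × List Bool => p.2 :=
    Computable.snd
  refine add.comp (sub.comp (Computable.list_length.comp Computable.fst)
    (snd.comp Computable.snd)) ?_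
  refine Computable.list_sum_map (str.comp (snd.comp Computable.snd)) ?_
  refine add.comp (sub.comp (fst.comp k1)
    (Computable.list_length.comp (hφ.comp Computable.snd))) ?_
  refine Computable.list_sum_map (str.comp (snd.comp k1)) ?_
  refine Computable.cond (and.comp ?_ (and.comp ?_ (Primrec.not.to_comp.comp ?_)))
    (Computable.const 1) (Computable.const 0)
  · exact eq.comp (take.comp (fst.comp k2) (hφ.comp η2)) (take.comp (fst.comp k2) (hφ.comp ψ2))
  · exact eq.comp (take.comp (Computable.list_length.comp σ2) η2) σ2
  · exact eq.comp (take.comp (Computable.list_length.comp σ2) ψ2) σ2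

theorem defects_eq_zero_iff {φ : List Bool → List Bool} {σ : List Bool} {k : ℕ} :
    defects φ σ k = 0 ↔ σ.length ≤ k.unpair.2 ∧ ∀ η ∈ strings k.unpair.2,
      k.unpair.1 ≤ (φ η).length ∧ ∀ η' ∈ strings k.unpair.2,
        (φ η).take k.unpair.1 = (φ η').take k.unpair.1 →
          η.take σ.length = σ → η'.take σ.length = σ := by
  simp only [defects, Nat.add_eq_zero_iff, Nat.sub_eq_zero_iff_le, List.sum_eq_zero_iff,
    List.mem_map, forall_exists_index, and_imp, forall_apply_eq_imp_iff₂]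
  simp [Bool.cond_eq_ite]

theorem exists_pre_eq (η : List Bool) : ∃ X : Cantor, X.pre η.length = η :=
  nonempty_cyl η

theorem take_value_eq {Φ : Cantor → Cantor} {φ : List Bool → List Bool}
    (hφ : ∀ (X : Cantor) (n : ℕ), Φ X ∈ cyl (φ (X.pre n))) {X : Cantor} {m n : ℕ}
    (h : m ≤ (φ (X.pre n)).length) : (φ (X.pre n)).take m = (Φ X).pre m :=
  take_of_mem_cyl (hφ X n) h

theorem mem_cyl_iff_take {X : Cantor} {σ : List Bool} {n : ℕ} (h : σ.length ≤ n) :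
    X ∈ cyl σ ↔ (X.pre n).take σ.length = σ := by
  rw [take_pre X h]
  rfl

theorem separates_of_defects {Φ : Cantor → Cantor} {φ : List Bool → List Bool}
    (hφ : ∀ (X : Cantor) (n : ℕ), Φ X ∈ cyl (φ (X.pre n))) {σ : List Bool} {k : ℕ}
    (h : defects φ σ k = 0) : Separates Φ σ k.unpair.1 := by
  obtain ⟨h1, h2⟩ := defects_eq_zero_iff.1 h
  intro Z Z' hZ
  rw [mem_cyl_iff_take h1, mem_cyl_iff_take h1]
  have hm (X : Cantor) := mem_strings.2 (length_pre X k.unpair.2)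
  refine (h2 _ (hm Z)).2 _ (hm Z') ?_
  rw [take_value_eq hφ (h2 _ (hm Z)).1, take_value_eq hφ (h2 _ (hm Z')).1, hZ]

/-- Guarantees that the search halts: injectivity supplies the level `m`, and the uniform use of `φ`
supplies a length `n` at which separation becomes a finite check. -/
theorem exists_defects_eq_zero {Φ : Cantor → Cantor} {φ : List Bool → List Bool}
    (hΦ : Continuous Φ) (hinj : Function.Injective Φ)
    (hmono : ∀ σ τ : List Bool, σ <+: τ → φ σ <+: φ τ)
    (hφ : ∀ (X : Cantor) (n : ℕ), Φ X ∈ cyl (φ (X.pre n)))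
    (hlen : ∀ (X : Cantor) (m : ℕ), ∃ n, m ≤ (φ (X.pre n)).length) (σ : List Bool) :
    ∃ k, defects φ σ k = 0 := by
  obtain ⟨m, hm⟩ := exists_separates hΦ hinj σ
  obtain ⟨n, hn, hn'⟩ := exists_length_le hmono hlen m σ.length
  refine ⟨Nat.pair m n, defects_eq_zero_iff.2 ?_⟩
  rw [Nat.unpair_pair]
  refine ⟨hn, fun η hη => ?_⟩
  obtain rfl := mem_strings.1 hη
  obtain ⟨X, hX⟩ := exists_pre_eq η
  have hX' := hn' X
  have e := take_value_eq hφ hX'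
  rw [hX] at hX' e
  refine ⟨hX', fun η' hη' => ?_⟩
  obtain ⟨X', hX1⟩ := exists_pre_eq η'
  rw [mem_strings.1 hη'] at hX1
  have e' := take_value_eq hφ (hn' X')
  rw [hX1] at e'
  have h1 := mem_cyl_iff_take (X := X) hn
  have h2 := mem_cyl_iff_take (X := X') hn
  rw [hX] at h1
  rw [hX1] at h2
  rw [e, e', ← h1, ← h2]
  exact hm X X'

theorem IsComputableReal.average {Φ : Cantor → Cantor} {φ : List Bool → List Bool}
    {c : List Bool → ℝ≥0} {s n : List Bool → ℕ} (hΦ : Measurable Φ) (hφc : Computable φ)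
    (hφ : ∀ (X : Cantor) (n : ℕ), Φ X ∈ cyl (φ (X.pre n))) (hs : Computable s) (hn : Computable n)
    (hle : ∀ σ, σ.length ≤ n σ) (hm : ∀ σ, ∀ η ∈ strings (n σ), s σ ≤ (φ η).length)
    (hc : IsComputableReal c) : IsComputableReal (average Φ c s) := by
  obtain ⟨g, hg, hcg⟩ := hc
  refine IsComputableReal.of_approx (g := fun σ N => ((strings (n σ)).map fun η =>
    bif decide (η.take σ.length = σ) then g ((φ η).take (s σ)) N else 0).sum /
      2 ^ (n σ - σ.length)) (C := fun σ => (strings (n σ)).length + 1) ?_ ?_ ?_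
  · refine Primrec.nat_div.to_comp.comp ?_ ?_
    · refine Computable.list_sum_map
        (primrec_strings.to_comp.comp (hn.comp Computable.fst)) ?_
      have hσ : Computable fun p : (List Bool × ℕ) × List Bool => p.1.1 :=
        Computable.fst.comp Computable.fst
      have take := (Primrec.list_take (α := Bool)).to_comp
      refine Computable.cond ?_ (hg.comp ?_ ?_) (Computable.const 0)
      · exact (Primrec.eq (α := List Bool)).decide.to_comp.comp
          (take.comp (Computable.list_length.comp hσ) Computable.snd) hσ
      · exact take.comp (hs.comp hσ) (hφc.comp Computable.snd)
      · exact Computable.snd.comp Computable.fst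
    · exact Primrec.two_pow.to_comp.comp (Primrec.nat_sub.to_comp.comp (hn.comp Computable.fst)
        (Computable.list_length.comp Computable.fst))
  · exact Computable.succ.comp
      (Computable.list_length.comp (primrec_strings.to_comp.comp hn))
  · intro σ N
    rw [coe_average_eq_sum hΦ hφ (hle σ) (hm σ), div_mul_eq_mul_div, ← List.sum_map_mul_right]
    rw [Nat.cast_add, Nat.cast_one]
    refine abs_natDiv_sub_le (by positivity) ?_
    rw [Nat.cast_list_sum, List.map_map]
    refine abs_list_sum_map_sub_le fun η _ => ?_
    by_cases h : η.take σ.length = σ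
    · simpa [h] using abs_mul_sub_le hcg ((φ η).take (s σ)) N
    · simp [h]

/-! ### Transfer of success -/

theorem Succeeds.exists_lt {b : List Bool → ℝ≥0} {Y : Cantor} (h : Succeeds b Y) (r : ℝ) :
    ∃ n, r < b (Y.pre n) := by
  by_contra! hcon
  have h1 : limsup (fun n => (b (Y.pre n) : ℝ≥0∞)) atTop ≤ (r.toNNReal : ℝ≥0∞) := by
    refine limsup_le_of_le (by isBoundedDefault) (Eventually.of_forall fun n => ?_)
    exact ENNReal.coe_le_coe.2 (NNReal.le_toNNReal_of_coe_le (hcon n))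
  rw [h] at h1
  exact ENNReal.coe_ne_top (top_le_iff.1 h1)

theorem succeeds_of_frequently {b : List Bool → ℝ≥0} {Y : Cantor}
    (h : ∀ (r : ℝ) (N : ℕ), ∃ n ≥ N, r ≤ b (Y.pre n)) : Succeeds b Y := by
  refine ENNReal.eq_top_of_forall_nnreal_le fun r => ?_
  refine le_limsup_of_frequently_le (frequently_atTop.2 fun N => ?_) (by isBoundedDefault)
  obtain ⟨n, hn, hr⟩ := h r N
  exact ⟨n, hn, ENNReal.coe_le_coe.2 (by exact_mod_cast hr)⟩

theorem exists_lt_saved {b : List Bool → ℝ≥0} {f : List Bool → ℕ → ℕ}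
    (hbf : ∀ σ n, |(b σ : ℝ) - (f σ n : ℝ) / 2 ^ n| ≤ 1 / 2 ^ n) {Y : Cantor}
    (h : Succeeds b Y) (r : ℝ) : ∃ n, r ≤ saved b f (Y.pre n) := by
  -- The threshold inverts the logarithmic lower bound of `log_le_saved`.
  obtain ⟨n, hn⟩ := h.exists_lt (Real.exp (2 * r + Real.log (f [] 0 + 4)))
  have hpos : (0 : ℝ) < b (Y.pre n) := (Real.exp_pos _).trans hn
  refine ⟨n, le_trans ?_ (log_le_saved hbf (by exact_mod_cast hpos))⟩
  have := (Real.lt_log_iff_exp_lt hpos).2 hn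
  linarith

end Cantor

theorem mainTheorem3 (Φ : Cantor → Cantor) (hΦ : Cantor.IsComputableMap Φ)
    (hinj : Function.Injective Φ) (X : Cantor)
    (hX : Cantor.ComputablyRandom Cantor.fairCoin X) :
    Cantor.ComputablyRandom (Cantor.fairCoin.map Φ) (Φ X) := by
  rintro ⟨b, ⟨f, hf, hbf⟩, hb, hsucc⟩
  have hmeas := hΦ.measurable
  have hcont := hΦ.continuous
  obtain ⟨φ, hφc, hmono, hφ, hlen⟩ := hΦ
  have := Measure.isProbabilityMeasure_map (μ := Cantor.fairCoin) hmeas.aemeasurable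
  obtain ⟨k, hk, hk0⟩ := Computable.exists_search (Cantor.computable_defects hφc)
    (Cantor.exists_defects_eq_zero hcont hinj hmono hφ hlen)
  have hs (σ) := Cantor.separates_of_defects hφ (hk0 σ)
  have hk1 (σ) := Cantor.defects_eq_zero_iff.1 (hk0 σ)
  have hc := hb.saved hbf
  refine hX ⟨Cantor.average Φ (Cantor.saved b f) fun σ => (k σ).unpair.1, ?_,
    hc.average hmeas hs, Cantor.succeeds_of_frequently fun r N => ?_⟩
  · exact Cantor.IsComputableReal.average hmeas hφc hφ
      (Computable.fst.comp (Computable.unpair.comp hk))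
      (Computable.snd.comp (Computable.unpair.comp hk)) (fun σ => (hk1 σ).1)
      (fun σ η hη => ((hk1 σ).2 η hη).1) (Cantor.IsComputableReal.saved hf hbf)
  -- The extra 1 pays for the largest possible later drop of the saved capital.
  · obtain ⟨j, hj⟩ := Cantor.exists_lt_saved hbf hsucc (r + 1)
    obtain ⟨n, hNn, hn⟩ := Cantor.exists_length_le hmono hlen j N
    refine ⟨n, hNn, Cantor.le_average hmeas hc hs (τ := (Φ X).pre j) (fun Z hZ => ?_)
      fun τ hτ => ?_⟩
    -- All `Z` in the cylinder share the value `φ (X.pre n)`, which already fixes the first `j` bits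
    -- of the image.
    · have hZ' : Z.pre n = X.pre n := by
        have := Cantor.pre_of_mem_cyl hZ
        rwa [Cantor.length_pre] at this
      have h := Cantor.take_of_mem_cyl (hφ Z n) (hn Z)
      rw [hZ', Cantor.take_of_mem_cyl (hφ X n) (hn X)] at h
      rw [h]
      exact Cantor.mem_cyl_pre _ _
    · have := Cantor.saved_prefix_le hbf hτ
      linarith
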